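/- A field extension $F \subseteq L$ is a radical extension if $L = F[\alpha]$ for some $\alpha \in L$ with $\alpha^n \in F$ for some positive integer $n$. It is a repeated radical extension if there are intermediate fields $F = L_0 \subseteq L_1 \subseteq \cdots \subseteq L_r = L$ such that $L_i$ is a radical extension of $L_{i-1}$ for each $0 < i \le r$. Theorem B. Let $Q$ be a subfield of the field $\mathbb{R}$ of real numbers, and let $Q \subseteq L$ be a repeated radical extension ($L$ an arbitrary field, not assumed to lie in $\mathbb{R}$) whose degree $|L:Q|$ is odd. Then every field $K$ with $Q \subseteq K \subseteq L$ is a repeated radical extension of $Q$. -/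

import Mathlib

/-- A field extension `L / F` is a *radical extension* if `L = F(α)` for some `α ∈ L` such that
`α ^ n ∈ F` for some positive integer `n`. (Such an `α` is algebraic, so `F(α) = F[α]`.) -/
def IsRadicalExtension (F L : Type*) [Field F] [Field L] [Algebra F L] : Prop :=
  ∃ α : L, (∃ n : ℕ, 0 < n ∧ α ^ n ∈ Set.range (algebraMap F L)) ∧
    IntermediateField.adjoin F {α} = ⊤

/-- A field extension `L / F` is a *repeated radical extension* if there are intermediate fields
`F = E 0 ⊆ E 1 ⊆ ⋯ ⊆ E r = L` such that each `E (i + 1)` is a radical extension of `E i`.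
Only the values `E 0, …, E r` matter; `IntermediateField.extendScalars h` is `E (i + 1)`
viewed as an extension of its subfield `E i`. -/
def IsRepeatedRadicalExtension (F L : Type*) [Field F] [Field L] [Algebra F L] : Prop :=
  ∃ (r : ℕ) (E : ℕ → IntermediateField F L), E 0 = ⊥ ∧ E r = ⊤ ∧
    ∀ i < r, ∃ h : E i ≤ E (i + 1),
      IsRadicalExtension (E i) (IntermediateField.extendScalars h)

/-! An extension of odd degree embeds in ℝ over `Q`, because the minimal polynomial of a primitive
element has a real root. Inside ℝ odd degree absorbs square roots, so the extension becomes a tower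
of steps `F ⊂ F(α)` with `α ^ p ∈ F` and `p` an odd prime. Such a tower gains no element whose
conjugates are all real (`OddRadicalTower.mem_of_hasRealConjugates`).

Induct on the degree, with first step `Q(α)`. If `α ∈ K`, pass to base `Q(α)`. Otherwise, unless `K
= Q`, induction gives a tower from `Q(α)` to `K(α)` whose first step adjoins some `β` with `β ^ q ∈
Q(α)`. It suffices to find `k ∈ K` outside `Q` with `k ^ q ∈ Q` (`exists_radical_mem`) and pass to
base `Q(k)`.

To find `k`, write `β = f(α)` over `K` and let `ζ` be a primitive `p`-th root of unity. The quotient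
`f(ζα) / f(ζ⁻¹α)` has absolute value 1 and its `q`-th power lies in `Q(α, ζ)`. Its real part is the
cosine of an angle with `cos (qθ)` already present, so it has only real conjugates, and the quotient
lies in `Q(α, ζ)`. Conjugating `α` gives `f(ζ²ⁿα) / β ∈ Q(α, ζ)` for all `n`. Fourier inversion then
puts `k / β` in `Q(α, ζ)` for a nonzero coefficient `k` of `f`, and realness puts it in `Q(α)`. -/

open Polynomial in
/-- `x` is algebraic over `F` and all its conjugates over `F` are real. -/
def HasRealConjugates (F : Subfield ℝ) (x : ℝ) : Prop :=
  IsIntegral F x ∧ ((minpoly F x).map (algebraMap F ℝ)).Splits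

/-- The field `F(x)` as a subfield of `ℝ`. -/
noncomputable def adjoinReal (F : Subfield ℝ) (x : ℝ) : Subfield ℝ :=
  (IntermediateField.adjoin F {x}).toSubfield

theorem mem_adjoinReal {F : Subfield ℝ} {x y : ℝ} :
    y ∈ adjoinReal F x ↔ y ∈ IntermediateField.adjoin F {x} := Iff.rfl

theorem le_adjoinReal (F : Subfield ℝ) (x : ℝ) : F ≤ adjoinReal F x := fun y hy =>
  (IntermediateField.adjoin F {x}).algebraMap_mem ⟨y, hy⟩

theorem self_mem_adjoinReal (F : Subfield ℝ) (x : ℝ) : x ∈ adjoinReal F x :=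
  IntermediateField.mem_adjoin_simple_self F x

theorem adjoinReal_le {F E : Subfield ℝ} {x : ℝ} (hF : F ≤ E) (hx : x ∈ E) :
    adjoinReal F x ≤ E := by
  refine IntermediateField.adjoin_le_subfield F {x} ?_ (by simpa using hx)
  rintro _ ⟨y, rfl⟩
  exact hF y.2

theorem adjoinReal_mono {F E : Subfield ℝ} (h : F ≤ E) (x : ℝ) :
    adjoinReal F x ≤ adjoinReal E x :=
  adjoinReal_le (h.trans (le_adjoinReal E x)) (self_mem_adjoinReal E x)

theorem adjoinReal_of_mem {F : Subfield ℝ} {x : ℝ} (hx : x ∈ F) : adjoinReal F x = F :=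
  le_antisymm (adjoinReal_le le_rfl hx) (le_adjoinReal F x)

theorem adjoinReal_sup (F X : Subfield ℝ) (x : ℝ) :
    adjoinReal F x ⊔ X = adjoinReal (F ⊔ X) x := by
  apply le_antisymm
  · exact sup_le (adjoinReal_mono le_sup_left x) (le_sup_right.trans (le_adjoinReal _ x))
  · exact adjoinReal_le (sup_le_sup_right (le_adjoinReal F x) X)
      ((le_sup_left : _ ≤ adjoinReal F x ⊔ X) (self_mem_adjoinReal F x))

/-! ### Elements whose conjugates are all real. -/

namespace HasRealConjugates

open Polynomial

theorem of_splits {F : Subfield ℝ} {x : ℝ} {f : F[X]} (hf : f ≠ 0) (hx : aeval x f = 0)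
    (hs : (f.map (algebraMap F ℝ)).Splits) : HasRealConjugates F x :=
  ⟨isAlgebraic_iff_isIntegral.mp ⟨f, hf, hx⟩,
    hs.of_dvd ((Polynomial.map_ne_zero_iff (algebraMap F ℝ).injective).mpr hf)
      (Polynomial.map_dvd _ (minpoly.dvd F x hx))⟩

theorem mono {F E : Subfield ℝ} (h : F ≤ E) {x : ℝ} (hx : HasRealConjugates F x) :
    HasRealConjugates E x := by
  have hc : (algebraMap E ℝ).comp (Subfield.inclusion h) = algebraMap F ℝ := rfl
  refine of_splits (f := (minpoly F x).map (Subfield.inclusion h)) ?_ ?_ ?_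
  · exact (Polynomial.map_ne_zero_iff (Subfield.inclusion h).injective).mpr (minpoly.ne_zero hx.1)
  · rw [aeval_def, eval₂_map, hc]
    exact minpoly.aeval F x
  · rw [Polynomial.map_map, hc]
    exact hx.2

theorem of_mem_adjoinReal {F : Subfield ℝ} {c x : ℝ} (hc : HasRealConjugates F c)
    (hx : x ∈ adjoinReal F c) : HasRealConjugates F x := by
  have : FiniteDimensional F (IntermediateField.adjoin F {c}) :=
    IntermediateField.adjoin.finiteDimensional hc.1
  refine ⟨?_, IntermediateField.splits_of_mem_adjoin F ℝ (S := {c}) ?_ hx⟩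
  · have h := IsIntegral.of_finite F (⟨x, hx⟩ : IntermediateField.adjoin F {c})
    exact h.map (IntermediateField.adjoin F {c}).val
  · rintro _ rfl
    exact hc

theorem of_complex_roots {F : Subfield ℝ} {x : ℝ} {f : F[X]} (hf : f ≠ 0) (hx : aeval x f = 0)
    (hr : ∀ z : ℂ, aeval z f = 0 → z.im = 0) : HasRealConjugates F x := by
  refine of_splits hf hx ((IsAlgClosed.splits ((f.map (algebraMap F ℝ)).map
    (algebraMap ℝ ℂ))).of_splits_map (algebraMap ℝ ℂ) fun z hz => ?_)
  have hz' := (mem_roots'.mp hz).2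
  rw [IsRoot, Polynomial.map_map, eval_map, ← IsScalarTower.algebraMap_eq, ← aeval_def] at hz'
  exact ⟨z.re, Complex.ext (by simp) (by simp [hr z hz'])⟩

/-- The Chebyshev equation `T_q(z) = cos (qθ)` has only real roots: with `z = cos w`, it forces `q w
= ± qθ + 2πk`, so `w` is real. -/
theorem cos_of_cos_mul {F : Subfield ℝ} {q : ℕ} (hq : 0 < q) {θ : ℝ}
    (h : Real.cos (q * θ) ∈ F) : HasRealConjugates F (Real.cos θ) := by
  have hmap : ∀ z : ℂ, aeval z (Chebyshev.T F q - C ⟨_, h⟩) =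
      (Chebyshev.T ℂ q).eval z - Real.cos (q * θ) := by
    intro z
    rw [map_sub, aeval_C, aeval_def, eval₂_eq_eval_map, Chebyshev.map_T]
    rfl
  have hmapR : aeval (Real.cos θ) (Chebyshev.T F q - C ⟨_, h⟩) = 0 := by
    rw [map_sub, aeval_C, aeval_def, eval₂_eq_eval_map, Chebyshev.map_T, Chebyshev.T_real_cos]
    exact sub_eq_zero.mpr (by simp; rfl)
  refine of_complex_roots (f := Chebyshev.T F q - C ⟨_, h⟩) ?_ hmapR ?_
  · intro h0
    have hd := Chebyshev.natDegree_T F (q : ℤ)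
    rw [sub_eq_zero.mp h0, natDegree_C] at hd
    simp at hd
    omega
  · intro z hz
    obtain ⟨w, rfl⟩ := Complex.cos_surjective z
    rw [hmap, Chebyshev.T_complex_cos, sub_eq_zero, Complex.ofReal_cos,
      Complex.cos_eq_cos_iff] at hz
    have hw : w.im = 0 := by
      have hq' : (q : ℝ) ≠ 0 := by positivity
      obtain ⟨k, hk | hk⟩ := hz <;>
      · have := congrArg Complex.im hk
        simpa [hq', eq_comm] using this
    obtain ⟨r, rfl⟩ : ∃ r : ℝ, w = r := ⟨w.re, Complex.ext (by simp) (by simp [hw])⟩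
    rw [← Complex.ofReal_cos]
    exact Complex.ofReal_im _

theorem of_sq_mem {F : Subfield ℝ} {x : ℝ} (hx : x ^ 2 ∈ F) : HasRealConjugates F x := by
  refine of_splits (f := X ^ 2 - C ⟨_, hx⟩) (X_pow_sub_C_ne_zero (by norm_num) _) ?_ ?_
  · simp [Algebra.algebraMap_eq_smul_one, Subfield.smul_def]
  · have : (X ^ 2 - C (⟨_, hx⟩ : F)).map (algebraMap F ℝ) = (X - C x) * (X - C (-x)) := by
      simp only [Polynomial.map_sub, Polynomial.map_pow, map_X, map_C]
      change X ^ 2 - C (x ^ 2) = _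
      simp
      ring
    rw [this]
    exact (Splits.X_sub_C _).mul (Splits.X_sub_C _)

/-- Every conjugate is a real `p`-th root of `x ^ p`, and for odd `p` only `x` is one. Separability
then makes the minimal polynomial linear. -/
theorem mem_of_odd_pow_mem {F : Subfield ℝ} {x : ℝ} {p : ℕ} (hp : Odd p) (hx : x ^ p ∈ F)
    (h : HasRealConjugates F x) : x ∈ F := by
  have hroots : ∀ y ∈ ((minpoly F x).map (algebraMap F ℝ)).roots, y = x := by
    intro y hy
    have hy' := (mem_roots'.mp hy).2
    rw [IsRoot, eval_map, ← aeval_def] at hy'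
    have hd : minpoly F x ∣ X ^ p - C ⟨_, hx⟩ := minpoly.dvd F x (by
      simp [Algebra.algebraMap_eq_smul_one, Subfield.smul_def])
    have := aeval_eq_zero_of_dvd_aeval_eq_zero hd hy'
    have hpow : y ^ p = x ^ p := by
      simpa [Algebra.algebraMap_eq_smul_one, Subfield.smul_def, sub_eq_zero] using this
    exact hp.strictMono_pow.injective hpow
  have hsep : ((minpoly F x).map (algebraMap F ℝ)).roots.Nodup :=
    nodup_roots ((minpoly.irreducible h.1).separable.map)
  have hcard : (minpoly F x).natDegree ≤ 1 := by
    rw [← natDegree_map (algebraMap F ℝ), h.2.natDegree_eq_card_roots]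
    have := Multiset.eq_replicate_of_mem hroots
    rw [this] at hsep
    simpa using Multiset.nodup_iff_count_le_one.mp hsep x
  obtain ⟨y, hy⟩ := minpoly.natDegree_eq_one_iff.mp
    (le_antisymm hcard (minpoly.natDegree_pos h.1))
  exact hy ▸ y.2

end HasRealConjugates

/-! ### Adjoining a real root of odd prime degree. -/

section PrimeDegree

open Polynomial

theorem pow_notMem_range_of_odd {F : Subfield ℝ} {α : ℝ} {p : ℕ} (hp : Odd p)
    (hα : α ^ p ∈ F) (hα' : α ∉ F) (b : F) : b ^ p ≠ (⟨_, hα⟩ : F) := by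
  intro hb
  have : (b : ℝ) ^ p = α ^ p := congrArg Subtype.val hb
  exact hα' (hp.strictMono_pow.injective this ▸ b.2)

theorem minpoly_of_prime_pow_mem {F : Subfield ℝ} {α : ℝ} {p : ℕ} (hp : p.Prime) (hodd : Odd p)
    (hα : α ^ p ∈ F) (hα' : α ∉ F) : minpoly F α = X ^ p - C ⟨_, hα⟩ :=
  (minpoly.eq_of_irreducible_of_monic
    (X_pow_sub_C_irreducible_of_prime hp (pow_notMem_range_of_odd hodd hα hα'))
    (by simp [Algebra.algebraMap_eq_smul_one, Subfield.smul_def])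
    (monic_X_pow_sub_C _ hp.ne_zero)).symm

theorem isIntegral_of_pow_mem {F : Subfield ℝ} {α : ℝ} {n : ℕ} (hn : n ≠ 0)
    (hα : α ^ n ∈ F) : IsIntegral F α :=
  ⟨X ^ n - C ⟨_, hα⟩, monic_X_pow_sub_C _ hn, by
    simp [Algebra.algebraMap_eq_smul_one, Subfield.smul_def]⟩

theorem finrank_adjoin_of_prime_pow_mem {F : Subfield ℝ} {α : ℝ} {p : ℕ} (hp : p.Prime)
    (hodd : Odd p) (hα : α ^ p ∈ F) (hα' : α ∉ F) :
    Module.finrank F (IntermediateField.adjoin F {α}) = p := by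
  rw [IntermediateField.adjoin.finrank (isIntegral_of_pow_mem hp.ne_zero hα),
    minpoly_of_prime_pow_mem hp hodd hα hα', natDegree_X_pow_sub_C]

theorem adjoinReal_eq_of_mem_of_notMem {F : Subfield ℝ} {α g : ℝ} {p : ℕ} (hp : p.Prime)
    (hodd : Odd p) (hα : α ^ p ∈ F) (hg : g ∈ adjoinReal F α) (hg' : g ∉ F) :
    adjoinReal F g = adjoinReal F α := by
  have hα' : α ∉ F := fun h => hg' (adjoinReal_of_mem h ▸ hg)
  have hfin : FiniteDimensional F (IntermediateField.adjoin F {α}) :=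
    IntermediateField.adjoin.finiteDimensional (isIntegral_of_pow_mem hp.ne_zero hα)
  have hle : IntermediateField.adjoin F {g} ≤ IntermediateField.adjoin F {α} :=
    IntermediateField.adjoin_simple_le_iff.mpr hg
  have hdvd := IntermediateField.finrank_dvd_of_le_right hle
  rw [finrank_adjoin_of_prime_pow_mem hp hodd hα hα'] at hdvd
  rcases (Nat.dvd_prime hp).mp hdvd with h1 | h1
  · rw [IntermediateField.finrank_adjoin_simple_eq_one_iff, IntermediateField.mem_bot] at h1
    obtain ⟨y, rfl⟩ := h1
    exact absurd y.2 hg'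
  · have := IntermediateField.eq_of_le_of_finrank_eq hle
      (h1.trans (finrank_adjoin_of_prime_pow_mem hp hodd hα hα').symm)
    rw [adjoinReal, this, adjoinReal]

end PrimeDegree

/-! ### Towers of odd prime radical steps. -/

/-- `E` is obtained from the real field `F` by adjoining a root of odd prime degree. -/
def OddRadicalStep (F E : Subfield ℝ) : Prop :=
  ∃ (α : ℝ) (p : ℕ), p.Prime ∧ Odd p ∧ α ^ p ∈ F ∧ α ∉ F ∧ E = adjoinReal F α

/-- `E` is obtained from the real field `F` by successively adjoining roots of odd prime degree. -/
def OddRadicalTower : Subfield ℝ → Subfield ℝ → Prop := Relation.ReflTransGen OddRadicalStep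

namespace OddRadicalTower

theorem adjoin {F : Subfield ℝ} {α : ℝ} {p : ℕ} (hp : p.Prime) (hodd : Odd p) (hα : α ^ p ∈ F) :
    OddRadicalTower F (adjoinReal F α) := by
  by_cases h : α ∈ F
  · rw [adjoinReal_of_mem h]
    exact Relation.ReflTransGen.refl
  · exact Relation.ReflTransGen.single ⟨α, p, hp, hodd, hα, h, rfl⟩

theorem le {F L : Subfield ℝ} (h : OddRadicalTower F L) : F ≤ L := by
  induction h with
  | refl => exact le_rfl
  | tail _ hs ih =>
    obtain ⟨α, p, -, -, -, -, rfl⟩ := hs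
    exact ih.trans (le_adjoinReal _ α)

/-- Each step either survives in the compositum or collapses, when its root already lies in the
enlarged field. -/
theorem sup {F L : Subfield ℝ} (h : OddRadicalTower F L) (X : Subfield ℝ) :
    OddRadicalTower (F ⊔ X) (L ⊔ X) := by
  induction h with
  | refl => exact Relation.ReflTransGen.refl
  | tail _ hs ih =>
    obtain ⟨α, p, hp, hodd, hα, -, rfl⟩ := hs
    rw [adjoinReal_sup]
    exact Relation.ReflTransGen.trans ih (adjoin hp hodd ((le_sup_left : _ ≤ _ ⊔ X) hα))

theorem of_le {F K L : Subfield ℝ} (h : OddRadicalTower F L) (hFK : F ≤ K) (hKL : K ≤ L) :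
    OddRadicalTower K L := by
  have := h.sup K
  rwa [sup_eq_right.mpr hFK, sup_eq_left.mpr hKL] at this

theorem adjoin_base {F L : Subfield ℝ} (h : OddRadicalTower F L) (c : ℝ) :
    OddRadicalTower (adjoinReal F c) (adjoinReal L c) := by
  have key : ∀ E, F ≤ E → E ⊔ adjoinReal F c = adjoinReal E c := fun E hE =>
    le_antisymm (sup_le (le_adjoinReal E c) (adjoinReal_mono hE c))
      (adjoinReal_le le_sup_left
        ((le_sup_right : _ ≤ E ⊔ adjoinReal F c) (self_mem_adjoinReal F c)))
  rw [← key F le_rfl, ← key L h.le]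
  exact h.sup _

/-- A new element in a step of prime degree generates it, so its real conjugates would make those of
`α` real, against `mem_of_odd_pow_mem`. -/
theorem mem_of_hasRealConjugates {F L : Subfield ℝ} (h : OddRadicalTower F L) {g : ℝ}
    (hg : g ∈ L) (hr : HasRealConjugates F g) : g ∈ F := by
  induction h using Relation.ReflTransGen.head_induction_on with
  | refl => exact hg
  | @head F E hs _ ih =>
    obtain ⟨α, p, hp, hodd, hα, hα', rfl⟩ := hs
    have hgE := ih (hr.mono (le_adjoinReal F α))
    by_contra hgF
    refine hα' (HasRealConjugates.mem_of_odd_pow_mem hodd hα (hr.of_mem_adjoinReal ?_))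
    rw [adjoinReal_eq_of_mem_of_notMem hp hodd hα hgE hgF]
    exact self_mem_adjoinReal F α

/-- Infinite degree is recorded as 0; excluding it makes the degree strictly drop in the main
induction. -/
theorem relfinrank_ne_zero {F L : Subfield ℝ} (h : OddRadicalTower F L) :
    Subfield.relfinrank F L ≠ 0 := by
  induction h with
  | refl => simp
  | @tail E E' hE hs ih =>
    obtain ⟨α, p, hp, hodd, hα, hα', rfl⟩ := hs
    rw [← Subfield.relfinrank_mul_relfinrank (OddRadicalTower.le hE) (le_adjoinReal E α)]
    refine mul_ne_zero ih ?_
    rw [Subfield.relfinrank_eq_finrank_of_le (le_adjoinReal E α)]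
    have := finrank_adjoin_of_prime_pow_mem hp hodd hα hα'
    exact fun h0 => hp.ne_zero (this.symm.trans h0)

end OddRadicalTower

/-! ### Complex fields `M(is)` over real fields. -/

/-- For a real field `M` and `s ≠ 0` with `s ^ 2 ∈ M`, the field `M(i s)` of complex numbers. -/
def complexHull (M : Subfield ℝ) (s : ℝ) (hs : s ≠ 0) (hs2 : s ^ 2 ∈ M) : Subfield ℂ where
  -- For `z = a + b(is)` one has `z.im * s = b * s ^ 2`, so the second condition amounts to `b ∈ M`.
  carrier := {z | z.re ∈ M ∧ z.im * s ∈ M}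
  mul_mem' := by
    rintro z w ⟨hz, hz'⟩ ⟨hw, hw'⟩
    refine ⟨?_, ?_⟩
    · have : (z * w).re = z.re * w.re - (z.im * s) * (w.im * s) / s ^ 2 := by
        rw [Complex.mul_re]; field_simp
      rw [this]
      exact sub_mem (mul_mem hz hw) (div_mem (mul_mem hz' hw') hs2)
    · have : (z * w).im * s = z.re * (w.im * s) + (z.im * s) * w.re := by
        rw [Complex.mul_im]; ring
      rw [this]
      exact add_mem (mul_mem hz hw') (mul_mem hz' hw)
  one_mem' := ⟨by simp, by simp⟩
  add_mem' := by
    rintro z w ⟨hz, hz'⟩ ⟨hw, hw'⟩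
    refine ⟨add_mem hz hw, ?_⟩
    rw [Complex.add_im, add_mul]
    exact add_mem hz' hw'
  zero_mem' := ⟨by simp, by simp⟩
  neg_mem' := by
    rintro z ⟨hz, hz'⟩
    refine ⟨neg_mem hz, ?_⟩
    rw [Complex.neg_im, neg_mul]
    exact neg_mem hz'
  inv_mem' := by
    rintro z ⟨hz, hz'⟩
    have hn : Complex.normSq z ∈ M := by
      have : Complex.normSq z = z.re * z.re + (z.im * s) * (z.im * s) / s ^ 2 := by
        rw [Complex.normSq_apply]; field_simp
      rw [this]
      exact add_mem (mul_mem hz hz) (div_mem (mul_mem hz' hz') hs2)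
    refine ⟨?_, ?_⟩
    · rw [Complex.inv_re]
      exact div_mem hz hn
    · rw [Complex.inv_im, div_mul_eq_mul_div, neg_mul]
      exact div_mem (neg_mem hz') hn

section ComplexHull

variable {M N : Subfield ℝ} {s : ℝ} {hs : s ≠ 0} {hM : s ^ 2 ∈ M} {hN : s ^ 2 ∈ N}

theorem mem_complexHull {z : ℂ} : z ∈ complexHull M s hs hM ↔ z.re ∈ M ∧ z.im * s ∈ M := Iff.rfl

theorem ofReal_mem_complexHull {x : ℝ} : (x : ℂ) ∈ complexHull M s hs hM ↔ x ∈ M := by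
  simp [mem_complexHull, zero_mem]

theorem complexHull_mono (h : M ≤ N) : complexHull M s hs hM ≤ complexHull N s hs hN :=
  fun _ hz => ⟨h hz.1, h hz.2⟩

/-- Both coordinates have real conjugates: `u.re` is a cosine whose `q`-fold angle has cosine in
`M`, and then `u.im * s` has its square in `M`. -/
theorem mem_complexHull_of_pow_mem (h : OddRadicalTower M N) {u : ℂ}
    (hu : u ∈ complexHull N s hs hN) (hnorm : ‖u‖ = 1) {q : ℕ} (hq : 0 < q)
    (huq : u ^ q ∈ complexHull M s hs hM) : u ∈ complexHull M s hs hM := by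
  have hexp : ∀ n : ℕ, u ^ n = Complex.exp ((n * u.arg : ℝ) * Complex.I) := by
    intro n
    conv_lhs => rw [← Complex.norm_mul_exp_arg_mul_I u, hnorm]
    rw [Complex.ofReal_one, one_mul, ← Complex.exp_nat_mul]
    push_cast
    ring_nf
  have hre : u.re = Real.cos u.arg := by
    have := congrArg Complex.re (hexp 1)
    rw [Complex.exp_ofReal_mul_I_re] at this
    simpa using this
  have hcos : Real.cos (q * u.arg) ∈ M := by
    have := huq.1
    rwa [hexp, Complex.exp_ofReal_mul_I_re] at this
  have hreM : u.re ∈ M := by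
    refine h.mem_of_hasRealConjugates hu.1 ?_
    rw [hre]
    exact .cos_of_cos_mul hq hcos
  refine ⟨hreM, h.mem_of_hasRealConjugates hu.2 (.of_sq_mem ?_)⟩
  have : (u.im * s) ^ 2 = (1 - u.re ^ 2) * s ^ 2 := by
    have h1 : u.re * u.re + u.im * u.im = 1 := by
      rw [← Complex.normSq_apply, Complex.normSq_eq_norm_sq, hnorm, one_pow]
    linear_combination s ^ 2 * h1
  rw [this]
  exact mul_mem (sub_mem (one_mem _) (pow_mem hreM 2)) hM

end ComplexHull

/-! ### Polynomial expressions in a radical and in its conjugates. -/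

open Polynomial in
theorem eval₂_mem_subfield {R E : Type*} [Semiring R] [Field E] (S : Subfield E) (i : R →+* E)
    (f : R[X]) {z : E} (hz : z ∈ S) (hi : ∀ r, i r ∈ S) : f.eval₂ i z ∈ S := by
  rw [eval₂_eq_sum_range]
  exact sum_mem fun n _ => mul_mem (hi _) (pow_mem hz n)

open Polynomial in
theorem exists_aeval_eq_of_mem_adjoinReal {F : Subfield ℝ} {α y : ℝ} (hα : IsIntegral F α)
    (hy : y ∈ adjoinReal F α) : ∃ f : F[X], aeval α f = y := by
  rw [mem_adjoinReal, ← IntermediateField.mem_toSubalgebra,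
    IntermediateField.adjoin_simple_toSubalgebra_of_isAlgebraic hα.isAlgebraic,
    Algebra.adjoin_singleton_eq_range_aeval] at hy
  exact hy

open Polynomial in
theorem exists_aeval_eq_natDegree_lt {F : Subfield ℝ} {α y : ℝ} {p : ℕ} (hp : p ≠ 0)
    (hα : α ^ p ∈ F) (hy : y ∈ adjoinReal F α) :
    ∃ f : F[X], aeval α f = y ∧ f.natDegree < p := by
  obtain ⟨f, hf⟩ := exists_aeval_eq_of_mem_adjoinReal (isIntegral_of_pow_mem hp hα) hy
  have hmon : (X ^ p - C (⟨_, hα⟩ : F)).Monic := monic_X_pow_sub_C _ hp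
  refine ⟨f %ₘ (X ^ p - C ⟨_, hα⟩), ?_, ?_⟩
  · rw [aeval_modByMonic_eq_self_of_root, hf]
    simp [Algebra.algebraMap_eq_smul_one, Subfield.smul_def]
  · have := natDegree_modByMonic_lt f hmon (fun h => hp (by
      simpa [natDegree_X_pow_sub_C] using congrArg natDegree h))
    rwa [natDegree_X_pow_sub_C] at this

open Polynomial in
/-- Extraction of a coefficient by a discrete Fourier transform. -/
theorem sum_inv_pow_mul_eval {E : Type*} [Field E] {ξ : E} {p : ℕ} (hξ : IsPrimitiveRoot ξ p)
    (f : E[X]) (hf : f.natDegree < p) {i : ℕ} (hi : i < p) (x : E) :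
    ∑ n ∈ Finset.range p, ((ξ ^ n) ^ i)⁻¹ * f.eval (ξ ^ n * x) = p * (f.coeff i * x ^ i) := by
  have hξ0 : ξ ≠ 0 := hξ.ne_zero (by omega)
  have key : ∀ m ∈ Finset.range p, ∑ n ∈ Finset.range p, ((ξ ^ n) ^ i)⁻¹ * (ξ ^ n) ^ m =
      if m = i then (p : E) else 0 := by
    intro m hm
    have hr : ∀ n, ((ξ ^ n) ^ i)⁻¹ * (ξ ^ n) ^ m = (ξ ^ m / ξ ^ i) ^ n := by
      intro n
      rw [div_pow, ← pow_mul, ← pow_mul, ← pow_mul, ← pow_mul, mul_comm n i, mul_comm n m,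
        div_eq_mul_inv, mul_comm]
    simp_rw [hr]
    split_ifs with h
    · subst h
      simp [div_self (pow_ne_zero m hξ0)]
    · have h1 : ξ ^ m / ξ ^ i ≠ 1 := fun h1 =>
        h (hξ.pow_inj (Finset.mem_range.mp hm) hi
          ((div_eq_one_iff_eq (pow_ne_zero i hξ0)).mp h1))
      rw [geom_sum_eq h1, div_pow, ← pow_mul, ← pow_mul, mul_comm m, mul_comm i, pow_mul,
        pow_mul, hξ.pow_eq_one]
      simp
  simp_rw [fun n => eval_eq_sum_range' hf (ξ ^ n * x), Finset.mul_sum]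
  rw [Finset.sum_comm]
  have : ∀ m ∈ Finset.range p, ∑ n ∈ Finset.range p,
      ((ξ ^ n) ^ i)⁻¹ * (f.coeff m * (ξ ^ n * x) ^ m) =
      if m = i then p * (f.coeff i * x ^ i) else 0 := by
    intro m hm
    have h2 : ∀ n, ((ξ ^ n) ^ i)⁻¹ * (f.coeff m * (ξ ^ n * x) ^ m) =
        (f.coeff m * x ^ m) * (((ξ ^ n) ^ i)⁻¹ * (ξ ^ n) ^ m) := by
      intro n
      rw [mul_pow]; ring
    simp_rw [h2]
    rw [← Finset.mul_sum, key m hm]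
    split_ifs with h
    · subst h; ring
    · simp
  rw [Finset.sum_congr rfl this, Finset.sum_ite_eq' , if_pos (Finset.mem_range.mpr hi)]

open Polynomial in
/-- A polynomial relation satisfied by `α` over a field `E` containing the `p`-th roots of unity
and `α ^ p` but not `α` is satisfied by all `ω * α` with `ω ^ p = 1`. -/
theorem eval₂_mul_root_of_unity_eq_zero {E : Subfield ℂ} {ζ α : ℂ} {p : ℕ} (hp : p.Prime)
    (hζ : IsPrimitiveRoot ζ p) (hζE : ζ ∈ E) (hα : α ^ p ∈ E) (hα' : α ∉ E) {P : E[X]}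
    (hP : P.eval₂ E.subtype α = 0) {ω : ℂ} (hω : ω ^ p = 1) :
    P.eval₂ E.subtype (ω * α) = 0 := by
  have hα0 : α ≠ 0 := fun h => hα' (h ▸ zero_mem E)
  have : NeZero p := ⟨hp.ne_zero⟩
  have hroot : ∀ z : ℂ, z ^ p = 1 → z ∈ E := by
    intro z hz
    obtain ⟨i, -, rfl⟩ := hζ.eq_pow_of_pow_eq_one hz
    exact pow_mem hζE i
  -- A root of this binomial in `E` would differ from `α` by a `p`-th root of unity, which lies in
  -- `E`, and so would put `α` in `E`.
  have hirr : Irreducible (X ^ p - C (⟨_, hα⟩ : E)) := by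
    refine X_pow_sub_C_irreducible_of_prime hp fun b hb => ?_
    have hb' : (b : ℂ) ^ p = α ^ p := congrArg Subtype.val hb
    have hb0 : (b : ℂ) ≠ 0 := fun h => by
      rw [h, zero_pow hp.ne_zero] at hb'
      exact pow_ne_zero p hα0 hb'.symm
    have h1 : α / b ∈ E := hroot _ (by
      rw [div_pow, hb', div_self (pow_ne_zero p hα0)])
    apply hα'
    have := mul_mem h1 b.2
    rwa [div_mul_cancel₀ _ hb0] at this
  have hmin := minpoly.eq_of_irreducible_of_monic (A := E) (x := α) hirr
    (by simp [Algebra.algebraMap_eq_smul_one, Subfield.smul_def])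
    (monic_X_pow_sub_C _ hp.ne_zero)
  have hd : X ^ p - C (⟨_, hα⟩ : E) ∣ P := hmin ▸ minpoly.dvd E α hP
  refine eval₂_eq_zero_of_dvd_of_eval₂_eq_zero _ _ hd ?_
  simp [mul_pow, hω]

theorem adjoinReal_comm (F : Subfield ℝ) (x y : ℝ) :
    adjoinReal (adjoinReal F x) y = adjoinReal (adjoinReal F y) x := by
  have key : ∀ x y, adjoinReal (adjoinReal F x) y ≤ adjoinReal (adjoinReal F y) x := fun x y =>
    adjoinReal_le (adjoinReal_mono (le_adjoinReal F y) x)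
      (le_adjoinReal _ x (self_mem_adjoinReal F y))
  exact le_antisymm (key x y) (key y x)

open Polynomial in
theorem exists_eval₂_eq_of_mem_complexHull {F : Subfield ℝ} {α s : ℝ} (hs : s ≠ 0)
    (hα : IsIntegral F α) (hF : s ^ 2 ∈ F) (hFα : s ^ 2 ∈ adjoinReal F α) {u : ℂ}
    (hu : u ∈ complexHull (adjoinReal F α) s hs hFα) :
    ∃ h : (complexHull F s hs hF)[X],
      h.eval₂ (complexHull F s hs hF).subtype (α : ℂ) = u := by
  obtain ⟨h₁, hh₁⟩ := exists_aeval_eq_of_mem_adjoinReal hα hu.1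
  obtain ⟨h₂, hh₂⟩ := exists_aeval_eq_of_mem_adjoinReal hα hu.2
  let j : F →+* complexHull F s hs hF :=
    (Complex.ofRealHom.comp F.subtype).codRestrict _ fun x => ofReal_mem_complexHull.mpr x.2
  have hj : ∀ (h : F[X]), (h.map j).eval₂ (complexHull F s hs hF).subtype (α : ℂ) =
      ((aeval α h : ℝ) : ℂ) := by
    intro h
    rw [eval₂_map, aeval_def]
    exact (hom_eval₂ h (algebraMap F ℝ) Complex.ofRealHom α).symm
  -- Used in the decomposition `u = u.re + (I / s) * (u.im * s)`, where both real coordinates are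
  -- polynomials in `α`.
  have hI : Complex.I / s ∈ complexHull F s hs hF := by
    rw [mem_complexHull, Complex.div_ofReal_re, Complex.div_ofReal_im]
    simp [hs]
  refine ⟨h₁.map j + C ⟨_, hI⟩ * h₂.map j, ?_⟩
  rw [eval₂_add, eval₂_mul, eval₂_C, hj, hj, hh₁, hh₂]
  have hs' : (s : ℂ) ≠ 0 := by exact_mod_cast hs
  apply Complex.ext
  · simp [Complex.mul_re, Complex.div_ofReal_re, Complex.div_ofReal_im]
  · simp [Complex.mul_im, Complex.div_ofReal_re, Complex.div_ofReal_im]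
    field_simp

theorem exists_primitiveRoot_hasRealConjugates_re {p : ℕ} (hp : p.Prime) (hodd : Odd p) :
    ∃ ζ : ℂ, IsPrimitiveRoot ζ p ∧ ζ.im ≠ 0 ∧
      ∀ F : Subfield ℝ, HasRealConjugates F ζ.re := by
  have hp2 : 2 < p := lt_of_le_of_ne hp.two_le (by rintro rfl; exact absurd hodd (by decide))
  have hp0 : (p : ℝ) ≠ 0 := by exact_mod_cast hp.ne_zero
  have hζ : Complex.exp (2 * Real.pi * Complex.I / p) =
      Complex.exp ((2 * Real.pi / p : ℝ) * Complex.I) := by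
    push_cast; ring_nf
  refine ⟨_, Complex.isPrimitiveRoot_exp p hp.ne_zero, ?_, fun F => ?_⟩
  · have hp3 : (2 : ℝ) < p := by exact_mod_cast hp2
    have hpi := Real.pi_pos
    rw [hζ, Complex.exp_ofReal_mul_I_im]
    refine (Real.sin_pos_of_pos_of_lt_pi (by positivity) ?_).ne'
    rw [div_lt_iff₀ (by positivity)]
    nlinarith
  · rw [hζ, Complex.exp_ofReal_mul_I_re]
    refine .cos_of_cos_mul hp.pos ?_
    rw [mul_div_cancel₀ _ hp0, Real.cos_two_pi]
    exact one_mem F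

open Polynomial in
theorem eval₂_mul_eq_of_root_of_unity {E E' : Subfield ℂ} {ζ α : ℂ} {p : ℕ} (hp : p.Prime)
    (hζ : IsPrimitiveRoot ζ p) (hE : E ≤ E') (hζE : ζ ∈ E') (hα : α ^ p ∈ E') (hα' : α ∉ E')
    {f : E'[X]} {h : E[X]}
    (H : f.eval₂ E'.subtype (ζ * α) = h.eval₂ E.subtype α * f.eval₂ E'.subtype (ζ⁻¹ * α))
    {ω : ℂ} (hω : ω ^ p = 1) :
    f.eval₂ E'.subtype (ζ * (ω * α)) =
      h.eval₂ E.subtype (ω * α) * f.eval₂ E'.subtype (ζ⁻¹ * (ω * α)) := by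
  have hincl : E'.subtype.comp (Subfield.inclusion hE) = E.subtype := rfl
  have hev : ∀ z : ℂ, (f.comp (C ⟨ζ, hζE⟩ * X) - h.map (Subfield.inclusion hE) *
      f.comp (C ⟨ζ⁻¹, inv_mem hζE⟩ * X)).eval₂ E'.subtype z =
      f.eval₂ E'.subtype (ζ * z) -
        h.eval₂ E.subtype z * f.eval₂ E'.subtype (ζ⁻¹ * z) := by
    intro z
    rw [eval₂_sub, eval₂_mul, eval₂_comp, eval₂_comp, eval₂_map, hincl, eval₂_mul, eval₂_mul,
      eval₂_C, eval₂_C, eval₂_X]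
    rfl
  have := eval₂_mul_root_of_unity_eq_zero hp hζ hζE hα hα' ((hev α).trans (sub_eq_zero.mpr H)) hω
  rwa [hev, sub_eq_zero] at this

/-! ### Descent of a radical from `K(α)` to `K`. -/

open Polynomial in
/-- If `L = K(α)` with `α ^ p ∈ Q ⊆ K`, and if `L` contains a root of odd degree over `Q(α)`, then
`K` contains a root of the same degree over `Q`. -/
theorem exists_radical_mem {Q K : Subfield ℝ} {α β : ℝ} {p q : ℕ} (hp : p.Prime) (hodd : Odd p)
    (hq : 0 < q) (hQK : Q ≤ K) (hα : α ^ p ∈ Q) (hαK : α ∉ K)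
    (hL : OddRadicalTower (adjoinReal Q α) (adjoinReal K α)) (hβ : β ∈ adjoinReal K α)
    (hβq : β ^ q ∈ adjoinReal Q α) (hβQ : β ∉ adjoinReal Q α) :
    ∃ k ∈ K, k ∉ Q ∧ k ^ q ∈ Q := by
  obtain ⟨ζ, hζ, hs, hrc⟩ := exists_primitiveRoot_hasRealConjugates_re hp hodd
  obtain ⟨c, hζre⟩ : ∃ c, ζ.re = c := ⟨_, rfl⟩
  obtain ⟨s, hζim⟩ : ∃ s, ζ.im = s := ⟨_, rfl⟩
  have hnorm : ‖ζ‖ = 1 := hζ.norm'_eq_one hp.ne_zero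
  have hcs : s ^ 2 = 1 - c ^ 2 := by
    have := Complex.normSq_apply ζ
    rw [Complex.normSq_eq_norm_sq, hnorm, hζre, hζim] at this
    linear_combination -this
  rw [hζre] at hrc
  rw [hζim] at hs
  have hs2 : ∀ F : Subfield ℝ, s ^ 2 ∈ adjoinReal F c := fun F => by
    rw [hcs]
    exact sub_mem (one_mem _) (pow_mem (self_mem_adjoinReal F c) 2)
  -- Since `ζ = c + is`, the field `H F` is `F(ζ)`.
  let H : Subfield ℝ → Subfield ℂ := fun F => complexHull (adjoinReal F c) s hs (hs2 F)
  have hH : ∀ {F E}, F ≤ E → H F ≤ H E := fun h => complexHull_mono (adjoinReal_mono h c)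
  have hζH : ∀ F, ζ ∈ H F := fun F =>
    ⟨hζre ▸ self_mem_adjoinReal F c, by rw [hζim, ← sq]; exact hs2 F⟩
  have hrH : ∀ {F : Subfield ℝ} {x : ℝ}, x ∈ F → (x : ℂ) ∈ H F := fun hx =>
    ofReal_mem_complexHull.mpr (le_adjoinReal _ c hx)
  set A := adjoinReal Q α with hA
  set L := adjoinReal K α with hLdef
  have hKL : K ≤ L := le_adjoinReal K α
  have hαA : α ∈ A := self_mem_adjoinReal Q α
  have hAL : A ≤ L := hL.le
  -- relations over `K` transfer from `α` to its conjugates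
  have hαH : (α : ℂ) ∉ H K := fun h =>
    hαK (((hrc K).of_mem_adjoinReal (ofReal_mem_complexHull.mp h)).mem_of_odd_pow_mem hodd
      (hQK hα))
  have hαpH : (α : ℂ) ^ p ∈ H K := by exact_mod_cast hrH (hQK hα)
  have transfer : ∀ (P : (H K)[X]), P.eval₂ (H K).subtype (α : ℂ) = 0 →
      ∀ ω : ℂ, ω ^ p = 1 → P.eval₂ (H K).subtype (ω * α) = 0 := fun P hP ω hω =>
    eval₂_mul_root_of_unity_eq_zero hp hζ (hζH K)
      hαpH hαH hP hω
  let j : K →+* H K := (Complex.ofRealHom.comp K.subtype).codRestrict _ fun x => hrH x.2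
  let j' : K →+* ℂ := Complex.ofRealHom.comp K.subtype
  have hj : ∀ (f : K[X]) (z : ℂ), (f.map j).eval₂ (H K).subtype z = f.eval₂ j' z := by
    intro f z
    rw [eval₂_map]
    rfl
  have hjα : ∀ f : K[X], f.eval₂ j' (α : ℂ) = ((aeval α f : ℝ) : ℂ) := fun f =>
    (hom_eval₂ f (algebraMap K ℝ) Complex.ofRealHom α).symm
  have transferK : ∀ f : K[X], aeval α f = 0 → ∀ ω : ℂ, ω ^ p = 1 → f.eval₂ j' (ω * α) = 0 := by
    intro f hf ω hω
    rw [← hj]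
    refine transfer _ ?_ ω hω
    rw [hj, hjα, hf, Complex.ofReal_zero]
  obtain ⟨f, hf, hfdeg⟩ := exists_aeval_eq_natDegree_lt hp.ne_zero (hQK hα) hβ
  have hβ0 : β ≠ 0 := fun h => hβQ (h ▸ zero_mem _)
  -- the conjugates of `β` over `K`
  let b : ℂ → ℂ := fun ω => f.eval₂ j' (ω * α)
  have hb1 : b 1 = β := by simp only [b, one_mul, hjα, hf]
  -- The relation `β * β⁻¹ = 1`, written with polynomials in `α`, is transferred to `ω * α`.
  have hb0 : ∀ ω : ℂ, ω ^ p = 1 → b ω ≠ 0 := by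
    intro ω hω h0
    obtain ⟨g, hg⟩ := exists_aeval_eq_of_mem_adjoinReal
      (isIntegral_of_pow_mem hp.ne_zero (hQK hα)) (inv_mem hβ)
    have := transferK (f * g - 1) (by simp [hf, hg, hβ0]) ω hω
    simp only [eval₂_sub, eval₂_mul, eval₂_one] at this
    rw [show f.eval₂ j' (ω * α) = 0 from h0] at this
    simp at this
  have hbL : ∀ ω : ℂ, ω ∈ H Q → b ω ∈ H L := fun ω hω =>
    eval₂_mem_subfield _ _ _ (mul_mem (hH (hQK.trans hKL) hω) (hrH (hAL hαA)))
      fun r => hrH (hKL r.2)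
  have hbq : ∀ ω : ℂ, ω ^ p = 1 → ω ∈ H Q → b ω ^ q ∈ H A := by
    intro ω hω hωQ
    obtain ⟨g, hg⟩ := exists_aeval_eq_of_mem_adjoinReal
      (isIntegral_of_pow_mem hp.ne_zero hα) hβq
    have := transferK (f ^ q - g.map (Subfield.inclusion hQK)) (by
      rw [map_sub, map_pow, hf, aeval_def, eval₂_map, sub_eq_zero]
      exact hg.symm) ω hω
    rw [eval₂_sub, eval₂_pow, sub_eq_zero, eval₂_map] at this
    change (f.eval₂ j' (ω * α)) ^ q ∈ H A
    rw [this]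
    exact eval₂_mem_subfield _ _ _
      (mul_mem (hH (le_adjoinReal Q α) hωQ) (hrH hαA)) fun r => hrH (le_adjoinReal Q α r.2)
  have hζp : ζ ^ p = 1 := hζ.pow_eq_one
  have hζip : ζ⁻¹ ^ p = 1 := by rw [inv_pow, hζp, inv_one]
  have hconj : b ζ⁻¹ = (starRingEnd ℂ) (b ζ) := by
    have h1 : ζ⁻¹ = (starRingEnd ℂ) ζ :=
      Complex.inv_eq_conj hnorm
    change f.eval₂ j' (ζ⁻¹ * α) = (starRingEnd ℂ) (f.eval₂ j' (ζ * α))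
    rw [hom_eval₂, map_mul, Complex.conj_ofReal, h1]
    congr 1
    ext x
    exact (Complex.conj_ofReal x).symm
  -- Numerator and denominator are complex conjugates, so the quotient lies on the unit circle.
  have hu : b ζ / b ζ⁻¹ ∈ H A := by
    refine mem_complexHull_of_pow_mem (hL.adjoin_base c) (hN := hs2 L)
      (div_mem (hbL _ (hζH Q)) (hbL _ (inv_mem (hζH Q)))) ?_ hq ?_
    · rw [norm_div, hconj, RCLike.norm_conj, div_self]
      exact norm_ne_zero_iff.mpr (hb0 ζ hζp)
    · rw [div_pow]
      exact div_mem (hbq _ hζp (hζH Q)) (hbq _ hζip (inv_mem (hζH Q)))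
  obtain ⟨h, hh⟩ : ∃ h : (H Q)[X], h.eval₂ (H Q).subtype (α : ℂ) = b ζ / b ζ⁻¹ := by
    refine exists_eval₂_eq_of_mem_complexHull hs (isIntegral_of_pow_mem hp.ne_zero
      (le_adjoinReal Q c hα)) (hs2 Q) (adjoinReal_comm Q c α ▸ hs2 A) ?_
    have := adjoinReal_comm Q c α
    simp only [mem_complexHull, this]
    exact hu
  have hstep : ∀ ω : ℂ, ω ^ p = 1 →
      b (ω * ζ) = h.eval₂ (H Q).subtype (ω * α) * b (ω * ζ⁻¹) := by
    intro ω hω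
    have := eval₂_mul_eq_of_root_of_unity hp hζ (hH hQK) (hζH K) hαpH hαH (f := f.map j) (h := h)
      (by
        rw [hj, hj, hh]
        exact (div_mul_cancel₀ _ (hb0 _ hζip)).symm) hω
    rw [hj, hj] at this
    simp only [b]
    rw [mul_comm ω ζ, mul_comm ω ζ⁻¹, mul_assoc, mul_assoc]
    exact this
  have hωH : ∀ n : ℕ, ζ ^ n ∈ H Q := fun n => pow_mem (hζH Q) n
  have hωp : ∀ n : ℕ, (ζ ^ n) ^ p = 1 := fun n => by
    rw [← pow_mul, mul_comm, pow_mul, hζp, one_pow]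
  -- The quotients from `hstep` at `ω = ζ ^ (2 * n + 1)` telescope; as `p` is odd, the powers of `ζ
  -- ^ 2` exhaust the `p`-th roots of unity.
  have hratio : ∀ n : ℕ, b ((ζ ^ 2) ^ n) / β ∈ H A := by
    intro n
    induction n with
    | zero =>
      rw [pow_zero, hb1, div_self (by exact_mod_cast hβ0)]
      exact one_mem _
    | succ n ih =>
      have hζ0 : ζ ≠ 0 := hζ.ne_zero hp.ne_zero
      have h1 := hstep (ζ ^ (2 * n + 1)) (hωp _)
      have e1 : ζ ^ (2 * n + 1) * ζ = (ζ ^ 2) ^ (n + 1) := by ring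
      have e2 : ζ ^ (2 * n + 1) * ζ⁻¹ = (ζ ^ 2) ^ n := by
        rw [pow_succ, mul_assoc, mul_inv_cancel₀ hζ0, mul_one, pow_mul]
      rw [e1, e2] at h1
      rw [h1, mul_div_assoc]
      refine mul_mem (eval₂_mem_subfield _ _ _ (mul_mem (hH (le_adjoinReal Q α) (hωH _))
        (hrH hαA)) fun r => hH (le_adjoinReal Q α) r.2) ih
  -- a nonzero coefficient of `f` is the desired root
  have hf0 : f ≠ 0 := by
    rintro rfl
    exact hβ0 (by simpa using hf.symm)
  have hξ : IsPrimitiveRoot (ζ ^ 2) p :=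
    hζ.pow_of_coprime 2 (Nat.coprime_two_left.mpr hodd)
  set i := f.natDegree with hi
  have hki : f.coeff i ≠ 0 := by rwa [hi, coeff_natDegree, Ne, leadingCoeff_eq_zero]
  have hα0 : α ≠ 0 := fun h => hαK (h ▸ zero_mem K)
  set k : ℝ := (f.coeff i : ℝ) with hk
  have hk0 : k ≠ 0 := fun h => hki (Subtype.ext h)
  have hkβ : ((k / β : ℝ) : ℂ) ∈ H A := by
    have hsum := sum_inv_pow_mul_eval hξ (f.map j') (by rwa [natDegree_map]) hfdeg (α : ℂ)
    have hmem : (∑ n ∈ Finset.range p, (((ζ ^ 2) ^ n) ^ i)⁻¹ * (b ((ζ ^ 2) ^ n) / β)) ∈ H A :=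
      sum_mem fun n _ => mul_mem (inv_mem (pow_mem (pow_mem (pow_mem (hζH A) 2) n) i)) (hratio n)
    have hβ0' : (β : ℂ) ≠ 0 := by exact_mod_cast hβ0
    have hα0' : (α : ℂ) ≠ 0 := by exact_mod_cast hα0
    have hp0' : (p : ℂ) ≠ 0 := by exact_mod_cast hp.ne_zero
    have heq : ((k / β : ℝ) : ℂ) =
        (∑ n ∈ Finset.range p, (((ζ ^ 2) ^ n) ^ i)⁻¹ * (b ((ζ ^ 2) ^ n) / β)) /
          (p * (α : ℂ) ^ i) := by
      rw [eq_div_iff (mul_ne_zero hp0' (pow_ne_zero i hα0'))]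
      simp_rw [← mul_div_assoc]
      rw [← Finset.sum_div, eq_div_iff hβ0']
      simp only [eval_map, coeff_map] at hsum
      rw [show (∑ n ∈ Finset.range p, (((ζ ^ 2) ^ n) ^ i)⁻¹ * b ((ζ ^ 2) ^ n)) = _ from hsum,
        show j' (f.coeff i) = (k : ℂ) from rfl]
      push_cast
      field_simp
    rw [heq]
    exact div_mem hmem (mul_mem (natCast_mem _ p) (pow_mem (hrH hαA) i))
  -- Being real, `k / β` lies in `A(c)`, so its conjugates over `A` are real; the tower from `A` to
  -- `L` then removes `c`.
  have hkA : k / β ∈ A := hL.mem_of_hasRealConjugates (div_mem (hKL (f.coeff i).2) hβ)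
    ((hrc A).of_mem_adjoinReal (ofReal_mem_complexHull.mp hkβ))
  refine ⟨k, (f.coeff i).2, fun hkQ => hβQ ?_, ?_⟩
  · have := div_mem (le_adjoinReal Q α hkQ) hkA
    rwa [div_div_cancel₀ hk0] at this
  -- If `k ^ q ∈ K` were in `Q(α)` but not in `Q`, it would generate `Q(α)`, forcing `α ∈ K`.
  · by_contra hkQ
    have hkqA : k ^ q ∈ A := by
      have := mul_mem (pow_mem hkA q) hβq
      rwa [div_pow, div_mul_cancel₀ _ (pow_ne_zero q hβ0)] at this
    have h1 := adjoinReal_eq_of_mem_of_notMem hp hodd hα hkqA hkQ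
    exact hαK (adjoinReal_le hQK (pow_mem (f.coeff i).2 q) (h1 ▸ hαA))

/-! ### Induction on the degree. -/

theorem OddRadicalTower.of_intermediate {Q K L : Subfield ℝ} (h : OddRadicalTower Q L)
    (hQK : Q ≤ K) (hKL : K ≤ L) : OddRadicalTower Q K := by
  induction hn : Subfield.relfinrank Q L using Nat.strong_induction_on generalizing Q K L with
  | _ n ih =>
  subst hn
  -- The induction hypothesis over a strictly larger base `F`, where the degree of `L` is smaller.
  have tower_of_le : ∀ {F E : Subfield ℝ}, ¬ F ≤ Q → Q ≤ F → F ≤ E → E ≤ L →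
      OddRadicalTower F E := by
    intro F E hne hQF hFE hEL
    have hFL := hFE.trans hEL
    refine ih _ ?_ (h.of_le hQF hFL) hFE hEL rfl
    have hmul := Subfield.relfinrank_mul_relfinrank hQF hFL
    have h0 := h.relfinrank_ne_zero
    have h1 : Subfield.relfinrank Q F ≠ 1 := fun h => hne (Subfield.relfinrank_eq_one_iff.mp h)
    rw [← hmul] at h0 ⊢
    have ha := left_ne_zero_of_mul h0
    have hb := right_ne_zero_of_mul h0
    exact lt_mul_of_one_lt_left (Nat.pos_of_ne_zero hb) (by omega)
  rcases Relation.ReflTransGen.cases_head h with rfl | ⟨L₁, hstep, hL₁⟩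
  · rw [le_antisymm hKL hQK]
    exact Relation.ReflTransGen.refl
  obtain ⟨α, p, hp, hodd, hα, hαQ, rfl⟩ := hstep
  have hL₁L := OddRadicalTower.le hL₁
  have hQL₁ := le_adjoinReal Q α
  have hL₁Q : ¬ adjoinReal Q α ≤ Q := fun h => hαQ (h (self_mem_adjoinReal Q α))
  have hαL := hL₁L (self_mem_adjoinReal Q α)
  by_cases hαK : α ∈ K
  · exact (OddRadicalTower.adjoin hp hodd hα).trans
      (tower_of_le hL₁Q hQL₁ (adjoinReal_le hQK hαK) hKL)
  have hML : adjoinReal K α ≤ L := adjoinReal_le hKL hαL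
  have hM : OddRadicalTower (adjoinReal Q α) (adjoinReal K α) :=
    tower_of_le hL₁Q hQL₁ (adjoinReal_mono hQK α) hML
  by_cases hKQ : K ≤ Q
  · rw [le_antisymm hKQ hQK]
    exact Relation.ReflTransGen.refl
  rcases Relation.ReflTransGen.cases_head hM with heq | ⟨L₂, hstep, hL₂⟩
  -- If `K(α) = Q(α)`, any `g ∈ K` outside `Q` generates `Q(α)` and brings `α` into `K`.
  · obtain ⟨g, hgK, hgQ⟩ := Set.not_subset.mp hKQ
    have hg : g ∈ adjoinReal Q α := heq ▸ le_adjoinReal K α hgK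
    have := adjoinReal_eq_of_mem_of_notMem hp hodd hα hg hgQ
    exact absurd (adjoinReal_le hQK hgK (this ▸ self_mem_adjoinReal Q α)) hαK
  obtain ⟨β, q, hq, hqodd, hβq, hβ, rfl⟩ := hstep
  obtain ⟨k, hkK, hkQ, hkq⟩ := exists_radical_mem hp hodd hq.pos hQK hα hαK hM
    (OddRadicalTower.le hL₂ (self_mem_adjoinReal _ β)) hβq hβ
  exact (OddRadicalTower.adjoin hq hqodd hkq).trans
    (tower_of_le (fun h => hkQ (h (self_mem_adjoinReal Q k))) (le_adjoinReal Q k)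
      (adjoinReal_le hQK hkK) hKL)

/-! ### Reduction of arbitrary exponents to odd primes. -/

theorem OddRadicalTower.adjoin_of_odd {F : Subfield ℝ} {α : ℝ} {n : ℕ} (hn : Odd n)
    (hα : α ^ n ∈ F) : OddRadicalTower F (adjoinReal F α) := by
  induction n using Nat.strong_induction_on generalizing F with
  | _ n ih =>
  by_cases h1 : n = 1
  · subst h1
    rw [adjoinReal_of_mem (by simpa using hα)]
    exact Relation.ReflTransGen.refl
  have hp := Nat.minFac_prime h1
  obtain ⟨m, hm⟩ := Nat.minFac_dvd n
  generalize n.minFac = p at hp hm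
  subst hm
  obtain ⟨hpo, hmo⟩ := Nat.odd_mul.mp hn
  have hle : adjoinReal F (α ^ m) ≤ adjoinReal F α :=
    adjoinReal_le (le_adjoinReal F α) (pow_mem (self_mem_adjoinReal F α) m)
  have heq : adjoinReal (adjoinReal F (α ^ m)) α = adjoinReal F α :=
    le_antisymm (adjoinReal_le hle (self_mem_adjoinReal F α))
      (adjoinReal_mono (le_adjoinReal F _) α)
  have htower := ih m (lt_mul_of_one_lt_left hmo.pos hp.one_lt) hmo
    (self_mem_adjoinReal F (α ^ m))
  rw [heq] at htower
  exact (OddRadicalTower.adjoin hp hpo (by rwa [← pow_mul, mul_comm])).trans htower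

open Polynomial in
theorem mem_of_sq_mem_of_odd_relfinrank {F E : Subfield ℝ} (hFE : F ≤ E)
    (hodd : Odd (Subfield.relfinrank F E)) {γ : ℝ} (hγE : γ ∈ E) (hγ : γ ^ 2 ∈ F) : γ ∈ F := by
  by_contra hγF
  have hirr : Irreducible (X ^ 2 - C (⟨_, hγ⟩ : F)) := by
    refine X_pow_sub_C_irreducible_of_prime Nat.prime_two fun b hb => hγF ?_
    have hb' : (b : ℝ) ^ 2 = γ ^ 2 := congrArg Subtype.val hb
    rcases sq_eq_sq_iff_eq_or_eq_neg.mp hb' with h | h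
    · exact h ▸ b.2
    · exact neg_mem_iff.mp (h ▸ b.2)
  have hmin := minpoly.eq_of_irreducible_of_monic (x := γ) hirr
    (by simp [Algebra.algebraMap_eq_smul_one, Subfield.smul_def])
    (monic_X_pow_sub_C _ two_ne_zero)
  have hdeg : Subfield.relfinrank F (adjoinReal F γ) = 2 := by
    rw [Subfield.relfinrank_eq_finrank_of_le (le_adjoinReal F γ)]
    have := IntermediateField.adjoin.finrank (isIntegral_of_pow_mem two_ne_zero hγ)
    rw [← hmin, natDegree_X_pow_sub_C] at this
    exact this
  rw [← Subfield.relfinrank_mul_relfinrank (le_adjoinReal F γ) (adjoinReal_le hFE hγE),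
    hdeg] at hodd
  exact (Nat.not_odd_iff_even.mpr (even_two_mul _)) hodd

/-- An even exponent can be halved: `α ^ m` is a square root over `F` inside an extension of odd
degree, hence already in `F`. -/
theorem OddRadicalTower.adjoin_of_odd_relfinrank {F E : Subfield ℝ} (hFE : F ≤ E)
    (hodd : Odd (Subfield.relfinrank F E)) {α : ℝ} (hαE : α ∈ E) {n : ℕ} (hn : 0 < n)
    (hα : α ^ n ∈ F) : OddRadicalTower F (adjoinReal F α) := by
  induction n using Nat.strong_induction_on with
  | _ n ih =>
  rcases n.even_or_odd with ⟨m, rfl⟩ | h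
  · refine ih m (by omega) (by omega)
      (mem_of_sq_mem_of_odd_relfinrank hFE hodd (pow_mem hαE m) ?_)
    rwa [← pow_mul, mul_two]
  · exact adjoin_of_odd h hα

/-! ### Passage between abstract extensions and subfields of ℝ. -/

theorem isRadicalExtension_extendScalars_iff {F L : Type*} [Field F] [Field L] [Algebra F L]
    {E E' : IntermediateField F L} (h : E ≤ E') :
    IsRadicalExtension E (IntermediateField.extendScalars h) ↔
      ∃ α : L, (∃ n : ℕ, 0 < n ∧ α ^ n ∈ E) ∧ E' = E ⊔ IntermediateField.adjoin F {α} := by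
  have key : ∀ α : IntermediateField.extendScalars h,
      IntermediateField.adjoin E {α} = ⊤ ↔ E' = E ⊔ IntermediateField.adjoin F {(α : L)} := by
    intro α
    rw [← (IntermediateField.lift_injective _).eq_iff, IntermediateField.lift_adjoin,
      IntermediateField.lift_top, Set.image_singleton,
      ← (IntermediateField.restrictScalars_injective F).eq_iff,
      IntermediateField.restrictScalars_adjoin, IntermediateField.adjoin_union,
      IntermediateField.adjoin_self, IntermediateField.extendScalars_restrictScalars]
    exact eq_comm
  constructor
  · rintro ⟨α, ⟨n, hn, y, hy⟩, hadj⟩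
    refine ⟨α, ⟨n, hn, ?_⟩, (key α).mp hadj⟩
    have : (y : L) = (α : L) ^ n := congrArg Subtype.val hy
    exact this ▸ y.2
  · rintro ⟨α, ⟨n, hn, hα⟩, hE'⟩
    have hαE' : α ∈ E' := hE' ▸ (le_sup_right : _ ≤ E ⊔ IntermediateField.adjoin F {α})
      (IntermediateField.mem_adjoin_simple_self F α)
    exact ⟨⟨α, hαE'⟩, ⟨n, hn, ⟨_, hα⟩, Subtype.ext rfl⟩, (key ⟨α, hαE'⟩).mpr hE'⟩

theorem sup_adjoin_map_toSubfield {Q : Subfield ℝ} {L : Type*} [Field L] [Algebra Q L]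
    (f : L →ₐ[Q] ℝ) (E : IntermediateField Q L) (α : L) :
    ((E ⊔ IntermediateField.adjoin Q {α}).map f).toSubfield =
      adjoinReal (E.map f).toSubfield (f α) := by
  rw [IntermediateField.map_sup, IntermediateField.adjoin_map, Set.image_singleton]
  apply le_antisymm
  · rw [IntermediateField.sup_toSubfield]
    refine sup_le (le_adjoinReal _ _) ?_
    refine IntermediateField.adjoin_le_subfield Q {f α} ?_ ?_
    · rintro _ ⟨y, rfl⟩
      exact le_adjoinReal _ _ ((E.map f).algebraMap_mem y)
    · simpa using self_mem_adjoinReal _ (f α)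
  · refine adjoinReal_le (fun y hy => (le_sup_left : E.map f ≤ _) hy) ?_
    exact (le_sup_right : _ ≤ E.map f ⊔ IntermediateField.adjoin Q {f α})
      (IntermediateField.mem_adjoin_simple_self Q (f α))

theorem bot_toSubfield_of_subfield (Q : Subfield ℝ) :
    (⊥ : IntermediateField Q ℝ).toSubfield = Q := by
  rw [IntermediateField.bot_toSubfield]
  exact Q.fieldRange_subtype

open Polynomial in
-- Without roots, the sign at 0 would agree with the signs at both infinities, which are opposite in
-- odd degree.
theorem exists_isRoot_of_monic_of_odd_natDegree {f : ℝ[X]} (hf : f.Monic)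
    (hodd : Odd f.natDegree) : ∃ x, f.IsRoot x := by
  by_contra! hroot
  have h0 : (0 : ℝ) ≤ f.leadingCoeff := by simp [hf.leadingCoeff]
  have h1 := zero_lt_eval_of_roots_lt_of_leadingCoeff_nonneg (x := 0)
    (fun y hy => absurd hy (hroot y)) h0
  have h2 := zero_lt_negOnePow_mul_eval_of_lt_roots_of_leadingCoeff_nonneg (x := 0)
    (fun y hy => absurd hy (hroot y)) h0
  rw [Int.negOnePow_odd _ (by exact_mod_cast hodd)] at h2
  push_cast at h2
  linarith

theorem nonempty_algHom_real_of_odd_finrank (Q : Subfield ℝ) (L : Type*) [Field L] [Algebra Q L]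
    (hodd : Odd (Module.finrank Q L)) : Nonempty (L →ₐ[Q] ℝ) := by
  have : FiniteDimensional Q L := Module.finite_of_finrank_pos hodd.pos
  let pb := Field.powerBasisOfFiniteOfSeparable Q L
  have hdeg : Odd ((minpoly Q pb.gen).map (algebraMap Q ℝ)).natDegree := by
    rwa [Polynomial.natDegree_map, pb.natDegree_minpoly, ← pb.finrank]
  obtain ⟨x, hx⟩ := exists_isRoot_of_monic_of_odd_natDegree
    ((minpoly.monic pb.isIntegral_gen).map (algebraMap Q ℝ)) hdeg
  exact ⟨pb.lift x (by rwa [Polynomial.IsRoot, Polynomial.eval_map] at hx)⟩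

theorem OddRadicalTower.of_isRepeatedRadicalExtension {Q : Subfield ℝ} {L : Type*} [Field L]
    [Algebra Q L] (hL : IsRepeatedRadicalExtension Q L) (hodd : Odd (Module.finrank Q L))
    (f : L →ₐ[Q] ℝ) :
    OddRadicalTower Q ((⊤ : IntermediateField Q L).map f).toSubfield := by
  obtain ⟨r, E, h0, hr, hE⟩ := hL
  set M := ((⊤ : IntermediateField Q L).map f).toSubfield with hM
  have hQM : Odd (Subfield.relfinrank Q M) := by
    have h1 : IntermediateField.relfinrank ⊥ ((⊤ : IntermediateField Q L).map f) =
        Module.finrank Q L := by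
      rw [IntermediateField.relfinrank_bot_left]
      exact ((IntermediateField.equivMap ⊤ f).symm.toLinearEquiv.finrank_eq).trans
        IntermediateField.finrank_top'
    have h2 : Subfield.relfinrank (⊥ : IntermediateField Q ℝ).toSubfield M =
        Module.finrank Q L := h1
    rwa [← h2, bot_toSubfield_of_subfield] at hodd
  have hEM : ∀ i, ((E i).map f).toSubfield ≤ M := fun i => IntermediateField.map_mono f le_top
  have key : ∀ i ≤ r, OddRadicalTower Q ((E i).map f).toSubfield := by
    intro i
    induction i with
    | zero =>
      intro _
      rw [h0, IntermediateField.map_bot, bot_toSubfield_of_subfield]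
      exact Relation.ReflTransGen.refl
    | succ i ih =>
      intro hi
      have htower := ih (by omega)
      obtain ⟨h, hrad⟩ := hE i hi
      obtain ⟨α, ⟨n, hn, hα⟩, hE'⟩ := (isRadicalExtension_extendScalars_iff h).mp hrad
      refine htower.trans ?_
      rw [hE', sup_adjoin_map_toSubfield]
      refine adjoin_of_odd_relfinrank (hEM i)
        (hQM.of_dvd_nat (Subfield.relfinrank_dvd_of_le_left _ htower.le))
        (⟨α, IntermediateField.mem_top, rfl⟩) hn
        (⟨α ^ n, hα, map_pow f α n⟩)
  have := key r le_rfl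
  rwa [hr] at this

theorem OddRadicalTower.isRepeatedRadicalExtension {Q : Subfield ℝ} {L : Type*} [Field L]
    [Algebra Q L] (f : L →ₐ[Q] ℝ)
    (h : OddRadicalTower Q ((⊤ : IntermediateField Q L).map f).toSubfield) :
    IsRepeatedRadicalExtension Q L := by
  have key : ∀ M, OddRadicalTower Q M → M ≤ ((⊤ : IntermediateField Q L).map f).toSubfield →
      ∃ (r : ℕ) (E : ℕ → IntermediateField Q L), E 0 = ⊥ ∧ ((E r).map f).toSubfield = M ∧
        ∀ i < r, ∃ α : L, (∃ n : ℕ, 0 < n ∧ α ^ n ∈ E i) ∧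
          E (i + 1) = E i ⊔ IntermediateField.adjoin Q {α} := by
    intro M hM
    induction hM with
    | refl =>
      intro _
      refine ⟨0, fun _ => ⊥, rfl, ?_, fun i hi => absurd hi (Nat.not_lt_zero i)⟩
      rw [IntermediateField.map_bot, bot_toSubfield_of_subfield]
    | tail _ hs ih =>
      obtain ⟨α, p, hp, -, hα, -, rfl⟩ := hs
      intro hle
      obtain ⟨r, E, h0, hr, hE⟩ := ih ((le_adjoinReal _ α).trans hle)
      -- The real root lies in the image of `f`, so it can be pulled back to `L`.
      obtain ⟨a, -, rfl⟩ := (hle (self_mem_adjoinReal _ α))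
      have hap : a ^ p ∈ E r := by
        rw [← hr] at hα
        obtain ⟨b, hb, hab⟩ := id hα
        have : b = a ^ p := f.injective (hab.trans (map_pow f a p).symm)
        exact this ▸ hb
      refine ⟨r + 1, fun i => if i ≤ r then E i else E r ⊔ IntermediateField.adjoin Q {a},
        by simpa using h0, ?_, fun i hi => ?_⟩
      · simp only [Nat.not_succ_le_self, if_false]
        rw [← hr]
        exact sup_adjoin_map_toSubfield f (E r) a
      · rcases (Nat.lt_succ_iff_lt_or_eq.mp hi) with hi | rfl
        · simp only [hi.le, Nat.succ_le_of_lt hi, if_true]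
          exact hE i hi
        · simp only [le_refl, Nat.not_succ_le_self, if_true, if_false]
          exact ⟨a, ⟨p, hp.pos, hap⟩, rfl⟩
  obtain ⟨r, E, h0, hr, hE⟩ := key _ h le_rfl
  refine ⟨r, E, h0, IntermediateField.map_injective f
    (IntermediateField.toSubfield_injective hr), fun i hi => ?_⟩
  have hle : E i ≤ E (i + 1) := by
    obtain ⟨α, -, hα⟩ := hE i hi
    exact hα ▸ le_sup_left
  exact ⟨hle, (isRadicalExtension_extendScalars_iff hle).mpr (hE i hi)⟩

theorem theoremB (Q : Subfield ℝ) (L : Type*) [Field L] [Algebra Q L]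
    (hL : IsRepeatedRadicalExtension Q L) (hodd : Odd (Module.finrank Q L))
    (K : IntermediateField Q L) :
    IsRepeatedRadicalExtension Q K := by
  obtain ⟨f⟩ := nonempty_algHom_real_of_odd_finrank Q L hodd
  have htop := OddRadicalTower.of_isRepeatedRadicalExtension hL hodd f
  -- The real copy of `K` is its image under the restriction of `f`, which lies between `Q` and the
  -- image of `L`.
  refine OddRadicalTower.isRepeatedRadicalExtension (f.comp K.val) (htop.of_intermediate ?_ ?_)
  · exact fun x hx =>
      ((⊤ : IntermediateField Q K).map (f.comp K.val)).algebraMap_mem ⟨x, hx⟩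
  · intro x hx
    obtain ⟨y, -, rfl⟩ := id hx
    exact ⟨y, IntermediateField.mem_top, rfl⟩
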